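/- Let $u\in L^2(\mathbb R)\cap L^\infty(\mathbb R)$ be real-valued. Let $H^+\subset L^2(\mathbb R)$ be the Hardy space of (complex-valued) $L^2$ functions whose Fourier transform vanishes a.e. on $(-\infty,0)$, let $C_+$ be the Cauchy projection of $L^2(\mathbb R)$ onto $H^+$, $\widehat{C_+\varphi}=\chi_{(0,\infty)}\hat\varphi$, and let $H^1(\mathbb R)$ be the $L^2$ Sobolev space of order $1$. Let $\frac1i\partial_x$ be the operator on $H^+$ with domain $H^+\cap H^1(\mathbb R)$, and let $$L_u\varphi=\frac1i\varphi_x-C_+(u\,C_+\varphi).$$ Then $L_u$ is a relatively compact perturbation of $\frac1i\partial_x$ on $H^+$, that is, $\frac1i\partial_x$ has nonempty resolvent set and $C_+uC_+\left(\frac1i\partial_x-z\right)^{-1}$ is a compact operator on $H^+$ for every $z$ in the resolvent set of $\frac1i\partial_x$. Moreover, $L_u$ is self-adjoint on $H^+$ with domain $H^+\cap H^1(\mathbb R)$. -/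

import Mathlib

open MeasureTheory TemperedDistribution
open scoped ENNReal FourierTransform SchwartzMap LineDeriv

noncomputable section

namespace BenjaminOno

/-- The complex Hilbert space `L²(ℝ)`. -/
abbrev L2 : Type := Lp ℂ 2 (volume : Measure ℝ)

/-- Multiplication by an essentially bounded function, as a bounded operator on `L²(ℝ)`. -/
def mulOp (m : ℝ → ℂ) (hm : MemLp m ∞ (volume : Measure ℝ)) : L2 →L[ℂ] L2 :=
  (ContinuousLinearMap.mul ℂ ℂ).holderL volume ∞ 2 2 (hm.toLp m)

theorem mulOp_coeFn (m : ℝ → ℂ) (hm : MemLp m ∞ (volume : Measure ℝ)) (f : L2) :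
    mulOp m hm f =ᵐ[volume] fun x => m x * f x := by
  have h := (ContinuousLinearMap.mul ℂ ℂ).coeFn_holder (r := 2) (hm.toLp m) f
  filter_upwards [h, hm.coeFn_toLp] with x hx hx'
  simpa [mulOp, hx'] using hx

/-- The Hardy space `H⁺`: the `L²` functions whose Fourier transform vanishes almost everywhere on
the negative half line. (This does not depend on the normalization `e^{-ixξ}` or `e^{-2πixξ}` of
the Fourier transform.) -/
def hardy : Submodule ℂ L2 where
  carrier := {f | ∀ᵐ ξ : ℝ, ξ < 0 → (𝓕 f : L2) ξ = 0}
  add_mem' := by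
    intro f g hf hg
    have h : (𝓕 (f + g) : L2) = 𝓕 f + 𝓕 g := FourierTransform.fourier_add f g
    simp only [Set.mem_ofPred_eq] at hf hg ⊢
    rw [h]
    filter_upwards [hf, hg, Lp.coeFn_add (𝓕 f : L2) (𝓕 g)] with ξ h1 h2 h3 h4
    rw [h3, Pi.add_apply, h1 h4, h2 h4, add_zero]
  zero_mem' := by
    have h : (𝓕 (0 : L2) : L2) = 0 := (Lp.fourierTransformₗᵢ ℝ ℂ).map_zero
    simp only [Set.mem_ofPred_eq]
    rw [h]
    filter_upwards [Lp.coeFn_zero ℂ 2 (volume : Measure ℝ)] with ξ h1 _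
    rw [h1, Pi.zero_apply]
  smul_mem' := by
    intro c f hf
    have h : (𝓕 (c • f) : L2) = c • 𝓕 f := FourierTransform.fourier_smul c f
    simp only [Set.mem_ofPred_eq] at hf ⊢
    rw [h]
    filter_upwards [hf, Lp.coeFn_smul c (𝓕 f : L2)] with ξ h1 h3 h4
    rw [h3, Pi.smul_apply, h1 h4, smul_zero]

theorem mem_hardy {f : L2} : f ∈ hardy ↔ ∀ᵐ ξ : ℝ, ξ < 0 → (𝓕 f : L2) ξ = 0 := Iff.rfl

theorem memLp_indicator_one {s : Set ℝ} (hs : MeasurableSet s) :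
    MemLp (s.indicator fun _ => (1 : ℂ)) ∞ (volume : Measure ℝ) :=
  (memLp_top_const (1 : ℂ)).indicator hs

theorem isClosed_hardy : IsClosed (hardy : Set L2) := by
  have h : (hardy : Set L2) =
      {f : L2 | mulOp _ (memLp_indicator_one (measurableSet_Iio (a := (0 : ℝ))))
        (Lp.fourierTransformₗᵢ ℝ ℂ f) = 0} := by
    ext f
    rw [SetLike.mem_coe, mem_hardy, Set.mem_ofPred_eq, Lp.ext_iff]
    constructor
    · intro hf
      filter_upwards [hf, Lp.coeFn_zero ℂ 2 (volume : Measure ℝ),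
        mulOp_coeFn _ (memLp_indicator_one (measurableSet_Iio (a := (0 : ℝ))))
          (Lp.fourierTransformₗᵢ ℝ ℂ f)] with ξ h1 h2 h3
      rw [h2, h3, Pi.zero_apply]
      by_cases hξ : ξ < 0
      · have h4 : (Lp.fourierTransformₗᵢ ℝ ℂ f : L2) ξ = 0 := h1 hξ
        rw [h4, mul_zero]
      · simp [hξ]
    · intro hf
      filter_upwards [hf, Lp.coeFn_zero ℂ 2 (volume : Measure ℝ),
        mulOp_coeFn _ (memLp_indicator_one (measurableSet_Iio (a := (0 : ℝ))))
          (Lp.fourierTransformₗᵢ ℝ ℂ f)] with ξ h1 h2 h3 hξ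
      rw [h2, h3, Pi.zero_apply] at h1
      simp only [Set.indicator, Set.mem_Iio, hξ, if_true, one_mul] at h1
      exact h1
  rw [h]
  exact isClosed_eq (by fun_prop) continuous_const

instance instCompleteSpaceHardy : CompleteSpace hardy := isClosed_hardy.completeSpace_coe

/-- The Cauchy projection `C₊` on `L²(ℝ)`: the Fourier multiplier with symbol `χ_{(0,∞)}`. -/
def cauchyProj : L2 →L[ℂ] L2 :=
  (Lp.fourierTransformₗᵢ ℝ ℂ).symm.toContinuousLinearEquiv.toContinuousLinearMap ∘L
    mulOp ((Set.Ioi (0 : ℝ)).indicator fun _ => 1) (memLp_indicator_one measurableSet_Ioi) ∘L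
    (Lp.fourierTransformₗᵢ ℝ ℂ).toContinuousLinearEquiv.toContinuousLinearMap

theorem fourier_cauchyProj (f : L2) :
    (𝓕 (cauchyProj f) : L2) =
      mulOp ((Set.Ioi (0 : ℝ)).indicator fun _ => 1) (memLp_indicator_one measurableSet_Ioi)
        (𝓕 f) :=
  (Lp.fourierTransformₗᵢ ℝ ℂ).apply_symm_apply _

theorem cauchyProj_mem_hardy (f : L2) : cauchyProj f ∈ hardy := by
  rw [mem_hardy, fourier_cauchyProj]
  filter_upwards [mulOp_coeFn ((Set.Ioi (0 : ℝ)).indicator fun _ => 1)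
    (memLp_indicator_one measurableSet_Ioi) (𝓕 f)] with ξ h hξ
  rw [h]
  simp [hξ.le]

/-- The bounded operator `φ ↦ C₊ (u C₊ φ)` on `H⁺`, for a bounded real function `u`. -/
def toeplitz (u : ℝ → ℝ) (hu : MemLp u ∞ (volume : Measure ℝ)) : hardy →L[ℂ] hardy :=
  (cauchyProj ∘L mulOp (fun x => (u x : ℂ)) hu.ofReal ∘L cauchyProj ∘L hardy.subtypeL).codRestrict
    hardy (fun _ => cauchyProj_mem_hardy _)

/-- The subspace `H⁺ ∩ H¹(ℝ)` of `H⁺`. -/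
def hardySobolev : Submodule ℂ hardy where
  carrier := {φ | MemSobolev 1 2 ((φ : L2) : 𝓢'(ℝ, ℂ))}
  add_mem' := by
    intro f g hf hg
    have := MemSobolev.add hf hg
    rw [← Lp.toTemperedDistributionCLM_apply, ← Lp.toTemperedDistributionCLM_apply,
      ← map_add] at this
    exact this
  zero_mem' := by
    have := memSobolev_fun_zero ℝ ℂ 1 2
    rw [← map_zero (Lp.toTemperedDistributionCLM ℂ (volume : Measure ℝ) 2)] at this
    exact this
  smul_mem' := by
    intro c f hf
    have := MemSobolev.smul c hf
    rw [← Lp.toTemperedDistributionCLM_apply, ← map_smul] at this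
    exact this

theorem mem_hardySobolev {φ : hardy} :
    φ ∈ hardySobolev ↔ MemSobolev 1 2 ((φ : L2) : 𝓢'(ℝ, ℂ)) := Iff.rfl

theorem toDistribution_injective {f g : L2} (h : (f : 𝓢'(ℝ, ℂ)) = g) : f = g :=
  LinearMap.ker_eq_bot.mp
    (Lp.ker_toTemperedDistributionCLM_eq_bot (F := ℂ) (μ := (volume : Measure ℝ)) (p := 2)) h

/-- The Fourier transform of the distributional derivative of an `L²` function. -/
theorem fourier_of_deriv_eq {f g : L2} (h : ∂_{(1 : ℝ)} (f : 𝓢'(ℝ, ℂ)) = g) :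
    (𝓕 g : L2) =ᵐ[volume] fun ξ => (2 * Real.pi * Complex.I) * ξ * (𝓕 f : L2) ξ := by
  have hw : (fun ξ : ℝ => ((((1 + ‖ξ‖ ^ 2) ^ (-1 : ℝ) : ℝ)) : ℂ)).HasTemperateGrowth := by fun_prop
  have hv : (fun ξ : ℝ => ((inner ℝ ξ (1 : ℝ) : ℝ) : ℂ)).HasTemperateGrowth := by fun_prop
  have hb : ∀ ξ : ℝ, (1 + ‖ξ‖ ^ 2) ^ (-1 : ℝ) = (1 + ξ ^ 2)⁻¹ := fun ξ => by
    rw [Real.rpow_neg_one, Real.norm_eq_abs, sq_abs]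
  have hvw := hv.mul hw
  have hwb : MemLp (fun ξ : ℝ => ((((1 + ‖ξ‖ ^ 2) ^ (-1 : ℝ) : ℝ)) : ℂ)) ∞
      (volume : Measure ℝ) := by
    refine memLp_top_of_bound hw.1.continuous.aestronglyMeasurable 1 (.of_forall fun ξ => ?_)
    rw [Complex.norm_real, hb, Real.norm_eq_abs, abs_of_nonneg (by positivity)]
    exact inv_le_one_of_one_le₀ (by nlinarith [sq_nonneg ξ])
  have hvwb : MemLp ((fun ξ : ℝ => ((inner ℝ ξ (1 : ℝ) : ℝ) : ℂ)) *
      fun ξ : ℝ => ((((1 + ‖ξ‖ ^ 2) ^ (-1 : ℝ) : ℝ)) : ℂ)) ∞ (volume : Measure ℝ) := by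
    refine memLp_top_of_bound hvw.1.continuous.aestronglyMeasurable 1 (.of_forall fun ξ => ?_)
    rw [Pi.mul_apply, norm_mul, Complex.norm_real, Complex.norm_real, hb,
      Real.norm_eq_abs (_⁻¹), abs_of_nonneg (a := (1 + ξ ^ 2)⁻¹) (by positivity),
      ← div_eq_mul_inv, div_le_one (by positivity)]
    simp only [Real.norm_eq_abs, RCLike.inner_apply, conj_trivial, one_mul]
    nlinarith [sq_nonneg (|ξ| - 1), sq_abs ξ]
  have h1 : 𝓕 (g : 𝓢'(ℝ, ℂ)) = _ := (congrArg 𝓕 h).symm.trans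
    (TemperedDistribution.fourier_lineDerivOp_eq (f : 𝓢'(ℝ, ℂ)) (1 : ℝ))
  rw [Lp.fourier_toTemperedDistribution_eq, Lp.fourier_toTemperedDistribution_eq] at h1
  have h2 := congrArg (smulLeftCLM ℂ
    (fun ξ : ℝ => ((((1 + ‖ξ‖ ^ 2) ^ (-1 : ℝ) : ℝ)) : ℂ))) h1
  rw [map_smul, smulLeftCLM_smulLeftCLM_apply hv hw,
    ← Lp.toTemperedDistribution_smul_eq (p := ∞) (q := 2) (r := 2) hw hwb,
    ← Lp.toTemperedDistribution_smul_eq (p := ∞) (q := 2) (r := 2) hvw hvwb,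
    ← Lp.toTemperedDistributionCLM_apply, ← Lp.toTemperedDistributionCLM_apply,
    ← map_smul] at h2
  have h3 := toDistribution_injective h2
  rw [Lp.ext_iff] at h3
  filter_upwards [h3, Lp.coeFn_lpSMul (r := 2) (hwb.toLp _) (𝓕 g : L2), hwb.coeFn_toLp,
    Lp.coeFn_lpSMul (r := 2) (hvwb.toLp _) (𝓕 f : L2), hvwb.coeFn_toLp,
    Lp.coeFn_smul (2 * Real.pi * Complex.I) ((hvwb.toLp _) • (𝓕 f : L2) : L2)]
    with ξ e1 e2 e3 e4 e5 e6
  rw [e2, e6, Pi.smul_apply, e4, Pi.smul_apply', Pi.smul_apply', e3, e5, Pi.mul_apply, hb] at e1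
  have hne : (((1 + ξ ^ 2)⁻¹ : ℝ) : ℂ) ≠ 0 := by
    exact_mod_cast (by positivity : (1 + ξ ^ 2)⁻¹ ≠ 0)
  simp only [RCLike.inner_apply, conj_trivial, one_mul, smul_eq_mul] at e1
  refine mul_left_cancel₀ hne (e1.trans ?_)
  ring

/-- Functions in `H⁺ ∩ H¹(ℝ)` have their weak derivative in `H⁺`. -/
theorem exists_deriv (φ : hardySobolev) :
    ∃ g : hardy, ∂_{(1 : ℝ)} (((φ : hardy) : L2) : 𝓢'(ℝ, ℂ)) = (g : L2) := by
  have h := MemSobolev.lineDerivOp (mem_hardySobolev.mp φ.2) (m := (1 : ℝ))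
  rw [sub_self, memSobolev_zero_iff] at h
  obtain ⟨g, hg⟩ := h
  refine ⟨⟨g, ?_⟩, hg⟩
  rw [mem_hardy]
  filter_upwards [fourier_of_deriv_eq hg, mem_hardy.mp (φ : hardy).2] with ξ h1 h2 h3
  rw [h1, h2 h3, mul_zero]

/-- The weak derivative `φ_x ∈ H⁺` of `φ ∈ H⁺ ∩ H¹(ℝ)`. -/
def weakDeriv (φ : hardySobolev) : hardy := (exists_deriv φ).choose

theorem weakDeriv_spec (φ : hardySobolev) :
    ∂_{(1 : ℝ)} (((φ : hardy) : L2) : 𝓢'(ℝ, ℂ)) = (weakDeriv φ : L2) :=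
  (exists_deriv φ).choose_spec

theorem weakDeriv_eq {φ : hardySobolev} {g : hardy}
    (h : ∂_{(1 : ℝ)} (((φ : hardy) : L2) : 𝓢'(ℝ, ℂ)) = (g : L2)) : weakDeriv φ = g :=
  Subtype.ext (toDistribution_injective ((weakDeriv_spec φ).symm.trans h))

/-- The operator `(1/i) ∂_x` on `H⁺` with domain `H⁺ ∩ H¹(ℝ)`. -/
def freeOp : hardy →ₗ.[ℂ] hardy where
  domain := hardySobolev
  toFun :=
    { toFun := fun φ => (1 / Complex.I) • weakDeriv φ
      map_add' := by
        intro φ ψ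
        rw [← smul_add]
        congr 1
        apply weakDeriv_eq
        have h : ∀ f g : L2, ((f + g : L2) : 𝓢'(ℝ, ℂ)) = (f : 𝓢'(ℝ, ℂ)) + g :=
          map_add (Lp.toTemperedDistributionCLM ℂ (volume : Measure ℝ) 2)
        simp only [Submodule.coe_add, h, LineDeriv.lineDerivOp_add, weakDeriv_spec]
      map_smul' := by
        intro c φ
        rw [RingHom.id_apply, smul_comm c]
        congr 1
        apply weakDeriv_eq
        have h : ∀ f : L2, ((c • f : L2) : 𝓢'(ℝ, ℂ)) = c • (f : 𝓢'(ℝ, ℂ)) :=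
          map_smul (Lp.toTemperedDistributionCLM ℂ (volume : Measure ℝ) 2) c
        simp only [Submodule.coe_smul, h, LineDeriv.lineDerivOp_smul, weakDeriv_spec] }

/-- The everywhere defined operator `C₊ u C₊` on `H⁺`. -/
def potential (u : ℝ → ℝ) (hu : MemLp u ∞ (volume : Measure ℝ)) : hardy →ₗ.[ℂ] hardy :=
  (toeplitz u hu : hardy →ₗ[ℂ] hardy).toPMap ⊤

/-- The Lax operator `L_u = (1/i) ∂_x - C₊ u C₊`; the domain of a difference is the intersection of
the two domains. -/
def laxOp (u : ℝ → ℝ) (hu : MemLp u ∞ (volume : Measure ℝ)) : hardy →ₗ.[ℂ] hardy :=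
  freeOp - potential u hu

section RelativelyCompact

variable {E : Type*} [NormedAddCommGroup E] [NormedSpace ℂ E]

/-- The bounded operator `R` is the resolvent `(A - z)⁻¹` of the unbounded operator `A`. -/
structure IsResolventAt (A : E →ₗ.[ℂ] E) (z : ℂ) (R : E →L[ℂ] E) : Prop where
  mem_domain : ∀ f : E, R f ∈ A.domain
  right_inv : ∀ f : E, A ⟨R f, mem_domain f⟩ - z • R f = f
  left_inv : ∀ φ : A.domain, R (A φ - z • (φ : E)) = φ

/-- `B` is relatively compact with respect to `A`: the domain of `B` contains that of `A`, the
resolvent set of `A` is nonempty, and `B (A - z)⁻¹` is a compact operator for every `z` in it. -/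
def IsRelativelyCompact (A B : E →ₗ.[ℂ] E) : Prop :=
  ∃ hAB : A.domain ≤ B.domain,
    (∃ (z : ℂ) (R : E →L[ℂ] E), IsResolventAt A z R) ∧
    ∀ (z : ℂ) (R : E →L[ℂ] E) (hR : IsResolventAt A z R),
      IsCompactOperator fun f : E => B ⟨R f, hAB (hR.mem_domain f)⟩

end RelativelyCompact

end BenjaminOno

end

/-
The Fourier transform turns `(1/i) ∂ₓ` into multiplication by `2πξ`, so every non-real `z` lies in
its resolvent set, the resolvent being the Fourier multiplier with symbol `r(ξ) = (2πξ - z)⁻¹`,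
which belongs to `L² ∩ L^∞`. A symmetric operator with resolvents at `z` and `conj z` is
self-adjoint, and this survives the bounded symmetric perturbation `C₊ u C₊`.

For the compactness, `C₊` commutes with the resolvent, which leaves `u(x) r(D)`. Its value at `f` is
`x ↦ u(x) ⟪k_x, 𝓕 f⟫`, where `k_x` has the constant norm `‖r‖` in `L²`. Hence `x ↦ u(x) ⟪k_x, ·⟫` is
an `L²` family of functionals, which is a limit of simple ones, and `u(x) r(D)` is a limit of
operators of finite rank. The first resolvent identity carries compactness from one `z` to all of
the resolvent set.
-/

namespace BenjaminOno

section SelfAdjoint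

variable {𝕜 H : Type*} [RCLike 𝕜] [NormedAddCommGroup H] [InnerProductSpace 𝕜 H] [CompleteSpace H]
  {A : H →ₗ.[𝕜] H}

open scoped InnerProductSpace LinearPMap

theorem isSelfAdjoint_of_adjoint_domain_le (hA : A.IsFormalAdjoint A)
    (hdense : Dense (A.domain : Set H)) (hdom : A†.domain ≤ A.domain) : IsSelfAdjoint A :=
  have hle : A ≤ A† := hA.le_adjoint hdense
  (LinearPMap.eq_of_le_of_domain_eq hle (hle.1.antisymm hdom)).symm

theorem isSelfAdjoint_sub_toPMap_top (hA : IsSelfAdjoint A) {B : H →L[𝕜] H}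
    (hB : (B : H →ₗ[𝕜] H).IsSymmetric) :
    IsSelfAdjoint (A - (B : H →ₗ[𝕜] H).toPMap ⊤) := by
  set L := A - (B : H →ₗ[𝕜] H).toPMap ⊤
  have hAA : A.IsFormalAdjoint A := by
    simpa only [LinearPMap.isSelfAdjoint_def.mp hA] using
      LinearPMap.adjoint_isFormalAdjoint hA.dense_domain
  have hdom : L.domain = A.domain := inf_top_eq _
  have hL (x : A.domain) (hx : (x : H) ∈ L.domain) : L ⟨x, hx⟩ = A x - B x := rfl
  have hdense : Dense (L.domain : Set H) := hdom ▸ hA.dense_domain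
  refine isSelfAdjoint_of_adjoint_domain_le ?_ hdense fun y hy => ?_
  · rintro ⟨x, hx⟩ ⟨y, hy⟩
    rw [hL ⟨x, hx.1⟩ hx, hL ⟨y, hy.1⟩ hy, inner_sub_left, inner_sub_right,
      hAA ⟨x, hx.1⟩ ⟨y, hy.1⟩, show ⟪B x, y⟫_𝕜 = ⟪x, B y⟫_𝕜 from hB x y]
  · rw [hdom, ← LinearPMap.isSelfAdjoint_def.mp hA]
    refine LinearPMap.mem_adjoint_domain_of_exists y ⟨L† ⟨y, hy⟩ + B y, fun x => ?_⟩
    have hx : (x : H) ∈ L.domain := hdom.ge x.2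
    calc ⟪L† ⟨y, hy⟩ + B y, (x : H)⟫_𝕜
        = ⟪y, L ⟨x, hx⟩⟫_𝕜 + ⟪y, B x⟫_𝕜 := by
          rw [inner_add_left, show ⟪B y, (x : H)⟫_𝕜 = ⟪y, B x⟫_𝕜 from hB y x,
            LinearPMap.adjoint_isFormalAdjoint hdense ⟨y, hy⟩ ⟨x, hx⟩]
      _ = ⟪y, A x⟫_𝕜 := by rw [← inner_add_right, hL, sub_add_cancel]

end SelfAdjoint

namespace IsResolventAt

open scoped InnerProductSpace ComplexConjugate

section Normed

variable {E : Type*} [NormedAddCommGroup E] [NormedSpace ℂ E] {A : E →ₗ.[ℂ] E} {z w : ℂ}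
  {R S : E →L[ℂ] E}

/-- This is the first resolvent identity. -/
theorem apply_eq_apply_add_smul (hR : IsResolventAt A z R) (hS : IsResolventAt A w S) (f : E) :
    S f = R (f + (w - z) • S f) :=
  calc S f = R (A ⟨S f, hS.mem_domain f⟩ - z • S f) := (hR.left_inv ⟨S f, hS.mem_domain f⟩).symm
    _ = R ((A ⟨S f, hS.mem_domain f⟩ - w • S f) + (w - z) • S f) := by
      rw [sub_smul, sub_add_sub_cancel]
    _ = R (f + (w - z) • S f) := by rw [hS.right_inv]

theorem isRelativelyCompact_toPMap_top {B : E →L[ℂ] E} (hR : IsResolventAt A z R)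
    (hBR : IsCompactOperator (B ∘ R)) : IsRelativelyCompact A ((B : E →ₗ[ℂ] E).toPMap ⊤) := by
  refine ⟨le_top, ⟨z, R, hR⟩, fun w S hS => ?_⟩
  have hfactor : B ∘ S = (B ∘ R) ∘ (ContinuousLinearMap.id ℂ E + (w - z) • S) :=
    funext fun f => congrArg B (hR.apply_eq_apply_add_smul hS f)
  change IsCompactOperator (B ∘ S)
  exact hfactor ▸ hBR.comp_clm _

end Normed

variable {H : Type*} [NormedAddCommGroup H] [InnerProductSpace ℂ H] {A : H →ₗ.[ℂ] H} {z : ℂ}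
  {R S : H →L[ℂ] H}

theorem inner_apply_left (hA : A.IsFormalAdjoint A) (hR : IsResolventAt A z R)
    (hS : IsResolventAt A (conj z) S) (f g : H) : ⟪R f, g⟫_ℂ = ⟪f, S g⟫_ℂ := by
  have hsymm := hA ⟨R f, hR.mem_domain f⟩ ⟨S g, hS.mem_domain g⟩
  calc ⟪R f, g⟫_ℂ = ⟪R f, A ⟨S g, hS.mem_domain g⟩ - conj z • S g⟫_ℂ := by rw [hS.right_inv]
    _ = ⟪A ⟨R f, hR.mem_domain f⟩ - z • R f, S g⟫_ℂ := by
      rw [inner_sub_left, inner_sub_right, inner_smul_left, inner_smul_right, hsymm]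
    _ = ⟪f, S g⟫_ℂ := by rw [hR.right_inv]

theorem dense_domain [CompleteSpace H] (hA : A.IsFormalAdjoint A) (hR : IsResolventAt A z R)
    (hS : IsResolventAt A (conj z) S) : Dense (A.domain : Set H) := by
  rw [Submodule.dense_iff_topologicalClosure_eq_top,
    Submodule.topologicalClosure_eq_top_iff, Submodule.eq_bot_iff]
  intro g hg
  have hSg : S g = 0 := ext_inner_left ℂ fun f => by
    rw [← hR.inner_apply_left hA hS, inner_zero_right]
    exact (Submodule.mem_orthogonal _ _).mp hg _ (hR.mem_domain f)
  have hdom : (⟨S g, hS.mem_domain g⟩ : A.domain) = 0 := Subtype.ext hSg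
  rw [← hS.right_inv g, hdom, A.map_zero, hSg, smul_zero, sub_zero]

theorem isSelfAdjoint [CompleteSpace H] (hA : A.IsFormalAdjoint A) (hR : IsResolventAt A z R)
    (hS : IsResolventAt A (conj z) S) : IsSelfAdjoint A := by
  have hdense := hR.dense_domain hA hS
  refine isSelfAdjoint_of_adjoint_domain_le hA hdense fun y hy => ?_
  set v := A.adjoint ⟨y, hy⟩ - conj z • y with hv
  have hSv : S v = y := ext_inner_left ℂ fun f => by
    have hadj := (LinearPMap.adjoint_isFormalAdjoint hdense).symm ⟨R f, hR.mem_domain f⟩ ⟨y, hy⟩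
    calc ⟪f, S v⟫_ℂ = ⟪R f, v⟫_ℂ := (hR.inner_apply_left hA hS f v).symm
      _ = ⟪A ⟨R f, hR.mem_domain f⟩ - z • R f, y⟫_ℂ := by
        rw [hv, inner_sub_left, inner_sub_right, inner_smul_left, inner_smul_right, hadj]
      _ = ⟪f, y⟫_ℂ := by rw [hR.right_inv]
  exact hSv ▸ hS.mem_domain v

end IsResolventAt

open scoped InnerProductSpace ComplexConjugate

section Multiplier

variable {m n : ℝ → ℂ}

/-- The Fourier multiplier on `L²(ℝ)` with essentially bounded symbol `m`; `cauchyProj` is the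
special case of the symbol `χ_{(0,∞)}`. -/
noncomputable def fourierMul (m : ℝ → ℂ) (hm : MemLp m ∞ (volume : Measure ℝ)) : L2 →L[ℂ] L2 :=
  (Lp.fourierTransformₗᵢ ℝ ℂ).symm.toContinuousLinearEquiv.toContinuousLinearMap ∘L
    mulOp m hm ∘L
    (Lp.fourierTransformₗᵢ ℝ ℂ).toContinuousLinearEquiv.toContinuousLinearMap

theorem cauchyProj_eq_fourierMul : cauchyProj =
    fourierMul ((Set.Ioi (0 : ℝ)).indicator fun _ => 1) (memLp_indicator_one measurableSet_Ioi) :=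
  rfl

theorem fourier_fourierMul (hm : MemLp m ∞ (volume : Measure ℝ)) (f : L2) :
    (𝓕 (fourierMul m hm f) : L2) = mulOp m hm (𝓕 f) :=
  (Lp.fourierTransformₗᵢ ℝ ℂ).apply_symm_apply _

theorem fourier_fourierMul_ae (hm : MemLp m ∞ (volume : Measure ℝ)) (f : L2) :
    (𝓕 (fourierMul m hm f) : L2) =ᵐ[volume] fun ξ => m ξ * (𝓕 f : L2) ξ :=
  fourier_fourierMul hm f ▸ mulOp_coeFn m hm _

theorem eq_of_fourier_ae_eq {f g : L2} (h : (𝓕 f : L2) =ᵐ[volume] (𝓕 g : L2)) : f = g :=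
  (Lp.fourierTransformₗᵢ ℝ ℂ).injective (Lp.ext h)

theorem fourierMul_comm (hm : MemLp m ∞ (volume : Measure ℝ))
    (hn : MemLp n ∞ (volume : Measure ℝ)) (f : L2) :
    fourierMul m hm (fourierMul n hn f) = fourierMul n hn (fourierMul m hm f) := by
  apply eq_of_fourier_ae_eq
  filter_upwards [fourier_fourierMul_ae hm (fourierMul n hn f), fourier_fourierMul_ae hn f,
    fourier_fourierMul_ae hn (fourierMul m hm f), fourier_fourierMul_ae hm f]
    with ξ hmn hn' hnm hm'
  rw [hmn, hn', hnm, hm', mul_left_comm]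

theorem fourierMul_mem_hardy (hm : MemLp m ∞ (volume : Measure ℝ)) {f : L2} (hf : f ∈ hardy) :
    fourierMul m hm f ∈ hardy := by
  rw [mem_hardy] at hf ⊢
  filter_upwards [fourier_fourierMul_ae hm f, hf] with ξ hξ hfξ hneg
  rw [hξ, hfξ hneg, mul_zero]

theorem mulOp_isSymmetric (hm : MemLp m ∞ (volume : Measure ℝ)) (hreal : ∀ x, conj (m x) = m x) :
    (mulOp m hm : L2 →ₗ[ℂ] L2).IsSymmetric := by
  intro f g
  rw [L2.inner_def, L2.inner_def]
  refine integral_congr_ae ?_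
  filter_upwards [mulOp_coeFn m hm f, mulOp_coeFn m hm g] with x hf hg
  simp only [ContinuousLinearMap.coe_coe, hf, hg, RCLike.inner_apply, map_mul, hreal]
  ring

theorem fourierMul_isSymmetric (hm : MemLp m ∞ (volume : Measure ℝ))
    (hreal : ∀ ξ, conj (m ξ) = m ξ) : (fourierMul m hm : L2 →ₗ[ℂ] L2).IsSymmetric := by
  intro f g
  simp only [ContinuousLinearMap.coe_coe]
  rw [← Lp.inner_fourier_eq, ← Lp.inner_fourier_eq f, fourier_fourierMul, fourier_fourierMul]
  exact mulOp_isSymmetric hm hreal _ _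

theorem cauchyProj_isSymmetric : (cauchyProj : L2 →ₗ[ℂ] L2).IsSymmetric :=
  fourierMul_isSymmetric _ fun ξ => by by_cases hξ : 0 < ξ <;> simp [hξ]

theorem toeplitz_isSymmetric {u : ℝ → ℝ} (hu : MemLp u ∞ (volume : Measure ℝ)) :
    (toeplitz u hu : hardy →ₗ[ℂ] hardy).IsSymmetric := fun f g =>
  calc ⟪cauchyProj (mulOp (fun x => (u x : ℂ)) hu.ofReal (cauchyProj f)), (g : L2)⟫_ℂ
    _ = ⟪mulOp (fun x => (u x : ℂ)) hu.ofReal (cauchyProj f), cauchyProj g⟫_ℂ :=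
      cauchyProj_isSymmetric _ _
    _ = ⟪cauchyProj (f : L2), mulOp (fun x => (u x : ℂ)) hu.ofReal (cauchyProj g)⟫_ℂ :=
      mulOp_isSymmetric _ (fun _ => Complex.conj_ofReal _) _ _
    _ = ⟪(f : L2), cauchyProj (mulOp (fun x => (u x : ℂ)) hu.ofReal (cauchyProj g))⟫_ℂ :=
      cauchyProj_isSymmetric _ _

end Multiplier

section FreeOp

theorem fourier_freeOp_ae (φ : freeOp.domain) :
    (𝓕 (freeOp φ : L2) : L2) =ᵐ[volume]
      fun ξ => (2 * Real.pi * ξ : ℝ) * (𝓕 ((φ : hardy) : L2) : L2) ξ := by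
  have h : (𝓕 (freeOp φ : L2) : L2) = (1 / Complex.I) • (𝓕 (weakDeriv φ : L2) : L2) :=
    FourierTransform.fourier_smul (1 / Complex.I) (weakDeriv φ : L2)
  rw [h]
  filter_upwards [Lp.coeFn_smul (1 / Complex.I) (𝓕 (weakDeriv φ : L2) : L2),
    fourier_of_deriv_eq (weakDeriv_spec φ)] with ξ hsmul hderiv
  rw [hsmul, Pi.smul_apply, hderiv, smul_eq_mul]
  push_cast
  field_simp

theorem freeOp_isFormalAdjoint : freeOp.IsFormalAdjoint freeOp := by
  intro φ ψ
  change ⟪(freeOp φ : L2), ((ψ : hardy) : L2)⟫_ℂ = ⟪((φ : hardy) : L2), (freeOp ψ : L2)⟫_ℂ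
  rw [← Lp.inner_fourier_eq, ← Lp.inner_fourier_eq ((φ : hardy) : L2), L2.inner_def, L2.inner_def]
  refine integral_congr_ae ?_
  filter_upwards [fourier_freeOp_ae φ, fourier_freeOp_ae ψ] with ξ hφ hψ
  simp only [hφ, hψ, RCLike.inner_apply, map_mul, Complex.conj_ofReal]
  ring

theorem fourier_freeOp_sub_smul_ae (z : ℂ) (φ : freeOp.domain) :
    (𝓕 ((freeOp φ - z • (φ : hardy) : hardy) : L2) : L2) =ᵐ[volume]
      fun ξ => (2 * Real.pi * ξ - z) * (𝓕 ((φ : hardy) : L2) : L2) ξ := by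
  have h : (𝓕 ((freeOp φ - z • (φ : hardy) : hardy) : L2) : L2) =
      𝓕 (freeOp φ : L2) - z • (𝓕 ((φ : hardy) : L2) : L2) := by
    change (Lp.fourierTransformₗᵢ ℝ ℂ) ((freeOp φ : L2) - z • ((φ : hardy) : L2)) = _
    rw [map_sub, map_smul]
    rfl
  rw [h]
  filter_upwards [Lp.coeFn_sub (𝓕 (freeOp φ : L2) : L2) (z • (𝓕 ((φ : hardy) : L2) : L2)),
    Lp.coeFn_smul z (𝓕 ((φ : hardy) : L2) : L2), fourier_freeOp_ae φ] with ξ hsub hsmul hφ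
  rw [hsub, Pi.sub_apply, hsmul, hφ, Pi.smul_apply, smul_eq_mul, ← sub_mul]
  push_cast
  rfl

end FreeOp

section SmulLeft

variable {E F : Type*} [NormedAddCommGroup E] [MeasurableSpace E] [BorelSpace E]
  [NormedAddCommGroup F] [NormedSpace ℂ F] [CompleteSpace F]

theorem smulLeftCLM_toTemperedDistribution [NormedSpace ℝ E] {μ : Measure E}
    [μ.HasTemperateGrowth] {p q : ℝ≥0∞} [Fact (1 ≤ p)] [Fact (1 ≤ q)] {g : E → ℂ}
    (hg : g.HasTemperateGrowth) {f : Lp F p μ} (hgf : MemLp (fun x => g x • f x) q μ) :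
    smulLeftCLM F g (f : 𝓢'(E, F)) = (hgf.toLp : Lp F q μ) := by
  ext ψ
  simp only [Lp.toTemperedDistribution_apply, smulLeftCLM_apply_apply]
  refine integral_congr_ae ?_
  filter_upwards [hgf.coeFn_toLp] with x hx
  simp [hx, hg, smul_smul, mul_comm]

end SmulLeft

section Sobolev

variable {E F : Type*} [NormedAddCommGroup E] [InnerProductSpace ℝ E] [FiniteDimensional ℝ E]
  [MeasurableSpace E] [BorelSpace E] [NormedAddCommGroup F] [InnerProductSpace ℂ F]
  [CompleteSpace F]

theorem memSobolev_two_of_memLp_fourier {s : ℝ} {f : Lp F 2 (volume : Measure E)}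
    (h : MemLp (fun ξ : E => (((1 + ‖ξ‖ ^ 2) ^ (s / 2) : ℝ) : ℂ) •
      (𝓕 f : Lp F 2 (volume : Measure E)) ξ) 2 volume) :
    MemSobolev s 2 (f : 𝓢'(E, F)) := by
  refine memSobolev_iff_exists_smulLeftCLM_fourier.mpr ⟨h.toLp, ?_⟩
  rw [Lp.fourier_toTemperedDistribution_eq]
  exact smulLeftCLM_toTemperedDistribution (by fun_prop) h

theorem memSobolev_one_two_of_memLp_norm_smul_fourier {f : Lp F 2 (volume : Measure E)}
    (h : MemLp (fun ξ : E => ‖ξ‖ • (𝓕 f : Lp F 2 (volume : Measure E)) ξ) 2 volume) :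
    MemSobolev 1 2 (f : 𝓢'(E, F)) := by
  have hf := Lp.memLp (𝓕 f : Lp F 2 (volume : Measure E))
  have hweight : Continuous fun ξ : E => (((1 + ‖ξ‖ ^ 2) ^ ((1 : ℝ) / 2) : ℝ) : ℂ) :=
    Complex.continuous_ofReal.comp <|
      Continuous.rpow_const (by fun_prop) fun _ => Or.inr (by norm_num)
  refine memSobolev_two_of_memLp_fourier <| (hf.norm.add h.norm).mono'
    (hweight.aestronglyMeasurable.smul hf.aestronglyMeasurable) (.of_forall fun ξ => ?_)
  have hsqrt : √(1 + ‖ξ‖ ^ 2) ≤ 1 + ‖ξ‖ :=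
    Real.sqrt_le_iff.mpr ⟨by positivity, by nlinarith [norm_nonneg ξ]⟩
  rw [Pi.add_apply, norm_smul, norm_smul, norm_norm, Complex.norm_real, ← Real.sqrt_eq_rpow,
    Real.norm_of_nonneg (Real.sqrt_nonneg _), ← one_add_mul]
  gcongr

end Sobolev

section Resolvent

variable {z : ℂ}

/-- The symbol `(2πξ - z)⁻¹` of the resolvent of `freeOp` at a non-real `z`. -/
noncomputable def resolventSymbol (z : ℂ) (ξ : ℝ) : ℂ := (2 * Real.pi * ξ - z)⁻¹

theorem abs_im_le_norm_two_pi_mul_sub (z : ℂ) (ξ : ℝ) : |z.im| ≤ ‖2 * Real.pi * ξ - z‖ := by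
  simpa using Complex.abs_im_le_norm (2 * Real.pi * ξ - z)

theorem two_pi_mul_sub_ne_zero (hz : z.im ≠ 0) (ξ : ℝ) : 2 * Real.pi * ξ - z ≠ 0 :=
  norm_pos_iff.mp ((abs_pos.mpr hz).trans_le (abs_im_le_norm_two_pi_mul_sub z ξ))

theorem continuous_resolventSymbol (hz : z.im ≠ 0) : Continuous (resolventSymbol z) :=
  Continuous.inv₀ (by fun_prop) (two_pi_mul_sub_ne_zero hz)

theorem memLp_top_resolventSymbol (hz : z.im ≠ 0) :
    MemLp (resolventSymbol z) ∞ (volume : Measure ℝ) :=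
  memLp_top_of_bound (continuous_resolventSymbol hz).aestronglyMeasurable |z.im|⁻¹ <|
    .of_forall fun ξ => by
      rw [resolventSymbol, norm_inv]
      exact inv_anti₀ (abs_pos.mpr hz) (abs_im_le_norm_two_pi_mul_sub z ξ)

theorem norm_resolventSymbol_sq (hz : z.im ≠ 0) (ξ : ℝ) :
    ‖resolventSymbol z ξ‖ ^ 2 =
      (z.im ^ 2)⁻¹ * (1 + (2 * Real.pi / z.im * ξ - z.re / z.im) ^ 2)⁻¹ := by
  have hnorm : ‖2 * Real.pi * ξ - z‖ ^ 2 = (2 * Real.pi * ξ - z.re) ^ 2 + z.im ^ 2 := by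
    rw [← Complex.normSq_eq_norm_sq, Complex.normSq_apply]
    simp
    ring
  rw [resolventSymbol, norm_inv, inv_pow, hnorm, ← mul_inv]
  congr 1
  field_simp
  ring

theorem memLp_two_resolventSymbol (hz : z.im ≠ 0) :
    MemLp (resolventSymbol z) 2 (volume : Measure ℝ) := by
  rw [memLp_two_iff_integrable_sq_norm (continuous_resolventSymbol hz).aestronglyMeasurable]
  simp only [norm_resolventSymbol_sq hz]
  exact ((integrable_inv_one_add_sq.comp_sub_right (z.re / z.im)).comp_mul_left'
    (by positivity)).const_mul _

/-- The resolvent of `freeOp` at a non-real `z`, as the restriction to `hardy` of a Fourier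
multiplier. -/
noncomputable def freeResolvent (z : ℂ) (hz : z.im ≠ 0) : hardy →L[ℂ] hardy :=
  (fourierMul (resolventSymbol z) (memLp_top_resolventSymbol hz) ∘L hardy.subtypeL).codRestrict
    hardy fun f => fourierMul_mem_hardy _ f.2

theorem fourier_freeResolvent_ae (hz : z.im ≠ 0) (f : hardy) :
    (𝓕 (freeResolvent z hz f : L2) : L2) =ᵐ[volume]
      fun ξ => resolventSymbol z ξ * (𝓕 (f : L2) : L2) ξ :=
  fourier_fourierMul_ae _ _

theorem freeResolvent_mem_domain (hz : z.im ≠ 0) (f : hardy) :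
    freeResolvent z hz f ∈ freeOp.domain := by
  change MemSobolev 1 2 ((freeResolvent z hz f : L2) : 𝓢'(ℝ, ℂ))
  apply memSobolev_one_two_of_memLp_norm_smul_fourier
  set g : L2 := 𝓕 (freeResolvent z hz f : L2) with hg
  have hbound : MemLp (fun ξ => (2 * Real.pi : ℂ)⁻¹ * ((𝓕 (f : L2) : L2) ξ + z * g ξ)) 2 volume :=
    ((Lp.memLp (𝓕 (f : L2) : L2)).add ((Lp.memLp g).const_mul z)).const_mul _
  refine hbound.congr_norm
    (continuous_norm.aestronglyMeasurable.smul (Lp.aestronglyMeasurable g)) ?_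
  filter_upwards [fourier_freeResolvent_ae hz f] with ξ hξ
  have hne := two_pi_mul_sub_ne_zero hz ξ
  rw [norm_smul, norm_norm, ← Complex.norm_real, ← norm_mul, hg, hξ, resolventSymbol]
  congr 1
  field_simp
  ring

theorem isResolventAt_freeResolvent (hz : z.im ≠ 0) :
    IsResolventAt freeOp z (freeResolvent z hz) where
  mem_domain := freeResolvent_mem_domain hz
  right_inv f := by
    refine Subtype.ext (eq_of_fourier_ae_eq ?_)
    filter_upwards [fourier_freeOp_sub_smul_ae z ⟨_, freeResolvent_mem_domain hz f⟩,
      fourier_freeResolvent_ae hz f] with ξ hsub hres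
    rw [hsub, hres, resolventSymbol, mul_inv_cancel_left₀ (two_pi_mul_sub_ne_zero hz ξ)]
  left_inv φ := by
    refine Subtype.ext (eq_of_fourier_ae_eq ?_)
    filter_upwards [fourier_freeOp_sub_smul_ae z φ,
      fourier_freeResolvent_ae hz (freeOp φ - z • (φ : hardy))] with ξ hsub hres
    rw [hres, hsub, resolventSymbol, inv_mul_cancel_left₀ (two_pi_mul_sub_ne_zero hz ξ)]

theorem freeOp_isSelfAdjoint : IsSelfAdjoint freeOp :=
  have hI : Complex.I.im ≠ 0 := by simp
  have hconj : (conj Complex.I).im ≠ 0 := by simp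
  (isResolventAt_freeResolvent hI).isSelfAdjoint freeOp_isFormalAdjoint
    (isResolventAt_freeResolvent hconj)

end Resolvent

section KernelOperator

variable {𝕜 α H F : Type*} [RCLike 𝕜] [MeasurableSpace α] {μ : Measure α}
  [NormedAddCommGroup H] [NormedSpace 𝕜 H] [NormedAddCommGroup F] [NormedSpace 𝕜 F]
  {p : ℝ≥0∞} [Fact (1 ≤ p)]

/-- The operator `f ↦ (x ↦ K x f)` defined by a `p`-integrable family `K` of bounded operators. For
`H` an `L²` space, `F = 𝕜` and `p = 2`, these are the Hilbert–Schmidt integral operators. -/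
noncomputable def kernelOp : Lp (H →L[𝕜] F) p μ →L[𝕜] H →L[𝕜] Lp F p μ :=
  ((ContinuousLinearMap.apply 𝕜 F : H →L[𝕜] (H →L[𝕜] F) →L[𝕜] F).compLpL₂ p μ).flip

theorem kernelOp_apply_ae (K : Lp (H →L[𝕜] F) p μ) (f : H) :
    kernelOp K f =ᵐ[μ] fun x => K x f :=
  (ContinuousLinearMap.apply 𝕜 F f).coeFn_compLp K

theorem isCompactOperator_kernelOp_indicatorConstLp [LocallyCompactSpace F] {s : Set α}
    (hs : MeasurableSet s) (hμs : μ s ≠ ∞) (T : H →L[𝕜] F) :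
    IsCompactOperator (kernelOp (indicatorConstLp p hs hμs T)) := by
  set J : F →L[𝕜] Lp F p μ :=
    ((ContinuousLinearMap.lsmul 𝕜 𝕜).flip.compLpL₂ p μ).flip (indicatorConstLp p hs hμs (1 : 𝕜))
  have hJT : kernelOp (indicatorConstLp p hs hμs T) = J ∘L T := by
    ext1 f
    apply Lp.ext
    filter_upwards [kernelOp_apply_ae (indicatorConstLp p hs hμs T) f,
      ((ContinuousLinearMap.lsmul 𝕜 𝕜).flip (T f)).coeFn_compLp
        (indicatorConstLp p hs hμs (1 : 𝕜)),
      indicatorConstLp_coeFn (p := p) (hs := hs) (hμs := hμs) (c := T),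
      indicatorConstLp_coeFn (p := p) (hs := hs) (hμs := hμs) (c := (1 : 𝕜))]
      with x hK hJ hT hone
    rw [hK, hT]
    refine Eq.trans ?_ hJ.symm
    rw [hone]
    by_cases hx : x ∈ s <;> simp [hx]
  rw [hJT]
  exact (isCompactOperator_of_locallyCompactSpace_dom T).clm_comp J

theorem isCompactOperator_kernelOp [ProperSpace F] (hp : p ≠ ∞) (K : Lp (H →L[𝕜] F) p μ) :
    IsCompactOperator (kernelOp K) := by
  induction K using Lp.induction hp with
  | indicatorConst T hs hμs => exact isCompactOperator_kernelOp_indicatorConstLp hs hμs.ne T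
  | add _ _ _ hK hK' =>
    rw [map_add]
    exact hK.add hK'
  | isClosed =>
    have hcont : Continuous fun K : Lp (H →L[𝕜] F) p μ => kernelOp K := kernelOp.continuous
    exact isClosed_setOfPred_isCompactOperator.preimage hcont

end KernelOperator

section FourierInversion

variable {E F : Type*} [NormedAddCommGroup E] [InnerProductSpace ℝ E] [FiniteDimensional ℝ E]
  [MeasurableSpace E] [BorelSpace E] [NormedAddCommGroup F]

theorem continuous_fourierInv [NormedSpace ℂ F] {f : E → F} (hf : Integrable f) :
    Continuous (𝓕⁻ f) :=
  Real.Lp.fourierTransformInv_toLp (memLp_one_iff_integrable.mpr hf) ▸ map_continuous _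

theorem integral_fourierInv_smul_eq [NormedSpace ℂ F] [CompleteSpace F] {f : E → ℂ} {g : E → F}
    (hf : Integrable f) (hg : Integrable g) : ∫ ξ, 𝓕⁻ f ξ • g ξ = ∫ x, f x • 𝓕⁻ g x := by
  have hflip : (-innerₗ E).flip = -innerₗ E := by
    ext x y
    simp [real_inner_comm]
  have h := VectorFourier.integral_fourierIntegral_smul_eq_flip (L := -innerₗ E)
    Real.continuous_fourierChar continuous_inner.neg hf hg
  simpa only [hflip, VectorFourier.fourierIntegral, Real.fourierInv_eq, LinearMap.neg_apply,
    neg_neg, innerₗ_apply_apply] using h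

theorem fourierInv_ae_eq_of_integrable [InnerProductSpace ℂ F] [CompleteSpace F]
    (f : Lp F 2 (volume : Measure E)) (hf : Integrable f) :
    (𝓕⁻ f : Lp F 2 (volume : Measure E)) =ᵐ[volume] 𝓕⁻ (f : E → F) := by
  refine ae_eq_of_integral_contDiff_smul_eq ((Lp.memLp _).locallyIntegrable one_le_two)
    (continuous_fourierInv hf).locallyIntegrable fun g hg hgc => ?_
  have hgc' : HasCompactSupport (Complex.ofRealCLM ∘ g) := hgc.comp_left rfl
  set ψ : 𝓢(E, ℂ) := hgc'.toSchwartzMap (Complex.ofRealCLM.contDiff.comp hg) with hψ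
  have hgψ (h : E → F) : ∫ x, g x • h x = ∫ x, ψ x • h x := by simp [hψ]
  rw [hgψ, hgψ]
  calc ∫ x, ψ x • (𝓕⁻ f : Lp F 2 (volume : Measure E)) x
      = 𝓕⁻ (f : 𝓢'(E, F)) ψ := by
        rw [Lp.fourierInv_toTemperedDistribution_eq, Lp.toTemperedDistribution_apply]
    _ = ∫ ξ, 𝓕⁻ (ψ : E → ℂ) ξ • f ξ := by
        rw [TemperedDistribution.fourierInv_apply, Lp.toTemperedDistribution_apply,
          SchwartzMap.fourierInv_coe]
    _ = ∫ x, ψ x • 𝓕⁻ (f : E → F) x := integral_fourierInv_smul_eq ψ.integrable hf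

end FourierInversion

theorem continuous_of_continuous_inner_of_continuous_norm {𝕜 H X : Type*} [RCLike 𝕜]
    [NormedAddCommGroup H] [InnerProductSpace 𝕜 H] [TopologicalSpace X] {k : X → H}
    (hinner : ∀ f, Continuous fun x => ⟪k x, f⟫_𝕜) (hnorm : Continuous fun x => ‖k x‖) :
    Continuous k := by
  refine continuous_iff_continuousAt.mpr fun y => tendsto_iff_norm_sub_tendsto_zero.mpr ?_
  have hsq (x : X) : ‖k x - k y‖ = √(‖k x‖ ^ 2 - 2 * RCLike.re ⟪k x, k y⟫_𝕜 + ‖k y‖ ^ 2) := by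
    rw [← @norm_sub_sq 𝕜, Real.sqrt_sq (norm_nonneg _)]
  have hcont : Continuous fun x => ‖k x - k y‖ := by
    simp only [hsq]
    have := RCLike.continuous_re.comp (hinner (k y))
    fun_prop
  simpa using hcont.tendsto y

section FourierKernel

variable {E : Type*} [NormedAddCommGroup E] [InnerProductSpace ℝ E] {m : E → ℂ}

theorem norm_fourierChar_smul_conj (x ξ : E) :
    ‖Real.fourierChar (-⟪ξ, x⟫_ℝ) • conj (m ξ)‖ = ‖m ξ‖ := by
  rw [Circle.norm_smul, RCLike.norm_conj]

variable [FiniteDimensional ℝ E] [MeasurableSpace E] [BorelSpace E]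

theorem memLp_fourierKernel (hm : MemLp m 2 volume) (x : E) :
    MemLp (fun ξ : E => Real.fourierChar (-⟪ξ, x⟫_ℝ) • conj (m ξ)) 2 volume :=
  hm.congr_norm
    (Continuous.aestronglyMeasurable (by fun_prop) |>.smul
      (Complex.continuous_conj.comp_aestronglyMeasurable hm.aestronglyMeasurable))
    (.of_forall fun ξ => (norm_fourierChar_smul_conj x ξ).symm)

/-- The vector of `L²` representing the functional `f ↦ 𝓕⁻ (m f) x`. -/
noncomputable def fourierKernel (hm : MemLp m 2 volume) (x : E) : Lp ℂ 2 (volume : Measure E) :=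
  (memLp_fourierKernel hm x).toLp

theorem inner_fourierKernel (hm : MemLp m 2 volume) (x : E) (f : Lp ℂ 2 (volume : Measure E)) :
    ⟪fourierKernel hm x, f⟫_ℂ = 𝓕⁻ (fun ξ => m ξ * f ξ) x := by
  rw [L2.inner_def, Real.fourierInv_eq]
  refine integral_congr_ae ?_
  filter_upwards [(memLp_fourierKernel hm x).coeFn_toLp] with ξ hξ
  rw [fourierKernel, hξ, RCLike.inner_apply, Circle.smul_def, Circle.smul_def, smul_eq_mul,
    smul_eq_mul, map_mul, Complex.conj_conj, ← Circle.coe_inv_eq_conj, AddChar.map_neg_eq_inv,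
    inv_inv]
  ring

theorem norm_fourierKernel (hm : MemLp m 2 volume) (x : E) :
    ‖fourierKernel hm x‖ = ‖hm.toLp‖ := by
  rw [fourierKernel, Lp.norm_toLp, Lp.norm_toLp,
    eLpNorm_congr_norm_ae (.of_forall (norm_fourierChar_smul_conj x))]

theorem continuous_fourierKernel (hm : MemLp m 2 volume) : Continuous (fourierKernel hm) := by
  refine continuous_of_continuous_inner_of_continuous_norm (𝕜 := ℂ) (fun f => ?_) ?_
  · simp only [inner_fourierKernel]
    exact continuous_fourierInv (hm.integrable_mul (Lp.memLp f))
  · simp only [norm_fourierKernel, continuous_const]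

theorem memLp_smul_innerSL_fourierKernel (hm : MemLp m 2 volume) {v : E → ℂ} {p : ℝ≥0∞}
    (hv : MemLp v p volume) :
    MemLp (fun x => v x • innerSL ℂ (fourierKernel hm x)) p volume := by
  refine (hv.norm.mul_const ‖hm.toLp‖).mono (hv.aestronglyMeasurable.smul
    ((innerSL ℂ).continuous.comp (continuous_fourierKernel hm)).aestronglyMeasurable)
    (.of_forall fun x => ?_)
  rw [norm_smul, innerSL_apply_norm, norm_fourierKernel, norm_mul, norm_norm, norm_norm]

end FourierKernel

section Compactness

variable {m v : ℝ → ℂ}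

theorem fourierMul_ae_eq_inner_fourierKernel (hm₂ : MemLp m 2 (volume : Measure ℝ))
    (hm : MemLp m ∞ (volume : Measure ℝ)) (f : L2) :
    fourierMul m hm f =ᵐ[volume] fun x => ⟪fourierKernel hm₂ x, (𝓕 f : L2)⟫_ℂ := by
  have hmul := mulOp_coeFn m hm (𝓕 f)
  have hint : Integrable (mulOp m hm (𝓕 f : L2)) :=
    (hm₂.integrable_mul (Lp.memLp (𝓕 f : L2))).congr hmul.symm
  filter_upwards [fourierInv_ae_eq_of_integrable _ hint] with x hx
  rw [inner_fourierKernel, ← Real.fourierInv_congr_ae hmul, ← hx]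
  rfl

theorem isCompactOperator_mulOp_comp_fourierMul (hv₂ : MemLp v 2 (volume : Measure ℝ))
    (hv : MemLp v ∞ (volume : Measure ℝ)) (hm₂ : MemLp m 2 (volume : Measure ℝ))
    (hm : MemLp m ∞ (volume : Measure ℝ)) :
    IsCompactOperator (mulOp v hv ∘L fourierMul m hm) := by
  have hK := memLp_smul_innerSL_fourierKernel hm₂ hv₂
  have hfactor : mulOp v hv ∘L fourierMul m hm = kernelOp (hK.toLp _) ∘L
      (Lp.fourierTransformₗᵢ ℝ ℂ).toContinuousLinearEquiv.toContinuousLinearMap := by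
    ext1 f
    apply Lp.ext
    filter_upwards [mulOp_coeFn v hv (fourierMul m hm f),
      fourierMul_ae_eq_inner_fourierKernel hm₂ hm f,
      kernelOp_apply_ae (hK.toLp _) (𝓕 f : L2), hK.coeFn_toLp] with x hvx hmx hKx hKx'
    rw [ContinuousLinearMap.comp_apply, hvx, hmx]
    refine Eq.trans ?_ hKx.symm
    rw [hKx', smul_apply, innerSL_apply_apply, smul_eq_mul]
  rw [hfactor]
  exact (isCompactOperator_kernelOp (p := 2) ENNReal.ofNat_ne_top (hK.toLp _)).comp_clm _

theorem isCompactOperator_toeplitz_comp_freeResolvent {u : ℝ → ℝ}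
    (hu₂ : MemLp u 2 (volume : Measure ℝ)) (hu : MemLp u ∞ (volume : Measure ℝ)) {z : ℂ}
    (hz : z.im ≠ 0) : IsCompactOperator (toeplitz u hu ∘ freeResolvent z hz) := by
  set r := fourierMul (resolventSymbol z) (memLp_top_resolventSymbol hz)
  set M := mulOp (fun x => (u x : ℂ)) hu.ofReal
  have hcomm (f : L2) : cauchyProj (M (cauchyProj (r f))) = cauchyProj (M (r (cauchyProj f))) := by
    rw [cauchyProj_eq_fourierMul, fourierMul_comm]
  have hcompact : IsCompactOperator fun f : hardy => cauchyProj (M (cauchyProj (r f))) := by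
    simp only [hcomm]
    exact (isCompactOperator_mulOp_comp_fourierMul hu₂.ofReal hu.ofReal
      (memLp_two_resolventSymbol hz) (memLp_top_resolventSymbol hz)).comp_clm
      (cauchyProj ∘L hardy.subtypeL) |>.clm_comp cauchyProj
  exact hcompact.codRestrict (V := hardy) (fun _ => cauchyProj_mem_hardy _) isClosed_hardy

theorem isRelativelyCompact_potential {u : ℝ → ℝ} (hu₂ : MemLp u 2 (volume : Measure ℝ))
    (hu : MemLp u ∞ (volume : Measure ℝ)) : IsRelativelyCompact freeOp (potential u hu) :=
  have hI : Complex.I.im ≠ 0 := by simp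
  (isResolventAt_freeResolvent hI).isRelativelyCompact_toPMap_top
    (isCompactOperator_toeplitz_comp_freeResolvent hu₂ hu hI)

theorem laxOp_isSelfAdjoint {u : ℝ → ℝ} (hu : MemLp u ∞ (volume : Measure ℝ)) :
    IsSelfAdjoint (laxOp u hu) :=
  isSelfAdjoint_sub_toPMap_top freeOp_isSelfAdjoint (toeplitz_isSymmetric hu)

end Compactness

end BenjaminOno

theorem theorem1 (u : ℝ → ℝ) (hu₂ : MeasureTheory.MemLp u 2 MeasureTheory.volume)
    (hu : MeasureTheory.MemLp u ⊤ MeasureTheory.volume) :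
    BenjaminOno.IsRelativelyCompact BenjaminOno.freeOp (BenjaminOno.potential u hu) ∧
      IsSelfAdjoint (BenjaminOno.laxOp u hu) ∧
      (BenjaminOno.laxOp u hu).domain = BenjaminOno.hardySobolev :=
  ⟨BenjaminOno.isRelativelyCompact_potential hu₂ hu, BenjaminOno.laxOp_isSelfAdjoint hu,
    inf_top_eq _⟩
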